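/- An ordered hypergraph is a hypergraph on a linearly ordered vertex set. For $r\ge k$ let $P_r^{(k)}$ (the monotone tight path) be the $k$-uniform ordered hypergraph with vertex set $\{1,\dots,r\}$ whose edges are all sets of $k$ consecutive vertices. For a $k$-uniform ordered hypergraph $G$, Builder and Painter play the following game on a sufficiently large finite linearly ordered vertex set, initially without edges: in each round Builder presents a new $k$-set of vertices as an edge, and Painter immediately gives it one of $t$ colors. The $t$-color on-line size Ramsey number $\tilde R_t(G)$ is the least $N$ such that Builder can force, by playing at most $N$ edges, a monochromatic copy of $G$ whose vertices appear in the order specified by $G$. For integers $t,m\ge 2$ let $Q_1$ be the poset consisting of $t$ disjoint (mutually incomparable) chains of $m-1$ elements each, and for $j>1$ let $Q_j$ be the poset of all down-sets of $Q_{j-1}$, ordered by inclusion. Let $a_i$ be the size of a largest antichain in $Q_i$, and let $\lg$ denote the base-$2$ logarithm. Theorem. For all integers $k,m,t\ge 2$ and $r=k+m-1$, $$\tilde R_t(P_r^{(k)})\le |Q_k|\cdot|Q_{k-1}|\prod_{i=1}^{k-1}a_i .$$ Moreover, for every $\varepsilon>0$ there is a number $M$, depending only on $\varepsilon$, such that for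 all integers $t,m\ge2$ with $tm\ge M$, $$|Q_3|\cdot|Q_2|\,a_2a_1\le |Q_3|\,(\lg|Q_3|)^{2+\frac1{t-1}+\varepsilon} \qquad\text{and}\qquad |Q_k|\cdot|Q_{k-1}|\prod_{i=1}^{k-1}a_i\le |Q_k|\,(\lg|Q_k|)^{2+\varepsilon}\quad\text{for all } k\ge4 .$$ -/

import Mathlib

/-- A `k`-uniform hypergraph on the vertex set `V`. It is an ordered hypergraph whenever `V` is
linearly ordered. -/
structure UniformHypergraph (k : ℕ) (V : Type) where
  edges : Set (Finset V)
  uniform : ∀ e ∈ edges, e.card = k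

/-- The set of the `k` consecutive vertices `i, i + 1, …, i + k - 1` in `Fin r`
(vertices are numbered from `0`). -/
def consecutive (r k i : ℕ) : Finset (Fin r) :=
  Finset.univ.filter fun v => i ≤ (v : ℕ) ∧ (v : ℕ) < i + k

theorem card_consecutive {r k i : ℕ} (h : i + k ≤ r) : (consecutive r k i).card = k := by
  have : (consecutive r k i).map Fin.valEmbedding = Finset.Ico i (i + k) := by
    ext x
    simp only [consecutive, Finset.mem_map, Finset.mem_filter, Finset.mem_univ, true_and,
      Fin.valEmbedding_apply, Finset.mem_Ico]
    constructor
    · rintro ⟨v, hv, rfl⟩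
      exact hv
    · intro hx
      exact ⟨⟨x, by omega⟩, hx, rfl⟩
  rw [← Finset.card_map Fin.valEmbedding, this]
  simp

/-- The monotone tight path `P_r^{(k)}`: `r` ordered vertices, and the edges are all sets of `k`
consecutive vertices. -/
def tightPath (k r : ℕ) : UniformHypergraph k (Fin r) where
  edges := {e | ∃ i, i + k ≤ r ∧ e = consecutive r k i}
  uniform := by
    rintro e ⟨i, hi, rfl⟩
    exact card_consecutive hi

/-- A position of the game on the vertex set `V` with `t` colors: `c e = none` if the set `e` has
not been played, and `c e = some i` if `e` has been played and received color `i`. -/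
abbrev Position (t : ℕ) (V : Type) : Type := Finset V → Option (Fin t)

/-- The played edges contain a monochromatic copy of `G`, the vertices of the copy
appearing in the order specified by `G`. -/
def HasMonoCopy {k t : ℕ} {W V : Type} [LinearOrder W] [LinearOrder V]
    (G : UniformHypergraph k W) (c : Position t V) : Prop :=
  ∃ (f : W ↪o V) (i : Fin t), ∀ e ∈ G.edges, c (e.map f.toEmbedding) = some i

/-- From the position `c`, Builder can force a monochromatic copy of `G` by playing at most `N`
further edges: either there is a monochromatic copy already, or Builder has a new edge `e` (a
`k`-set of vertices not played before) such that, whichever color Painter gives to `e`, Builder can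
force a monochromatic copy by playing at most `N - 1` further edges. -/
def BuilderForces {k t : ℕ} {W V : Type} [LinearOrder W] [LinearOrder V]
    (G : UniformHypergraph k W) : ℕ → Position t V → Prop
  | 0, c => HasMonoCopy G c
  | N + 1, c => HasMonoCopy G c ∨
      ∃ e : Finset V, e.card = k ∧ c e = none ∧
        ∀ i : Fin t, BuilderForces G N (Function.update c e (some i))

/-- The `t`-color on-line size Ramsey number of the ordered hypergraph `G`: the least `N` such that
on some (large) finite ordered vertex set, initially without edges, Builder can force a
monochromatic copy of `G` by playing at most `N` edges. It is `⊤` if there is no such `N`. -/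
noncomputable def onlineSizeRamsey {k : ℕ} {W : Type} [LinearOrder W] (t : ℕ)
    (G : UniformHypergraph k W) : ℕ∞ :=
  ⨅ N ∈ {N : ℕ | ∃ n : ℕ, BuilderForces G N (fun _ => none : Position t (Fin n))}, (N : ℕ∞)

/-- The posets `Q_j`, `j ≥ 1`: `Q_1` is the disjoint union of `t` chains of `m - 1` elements each
(elements of different chains being incomparable), and for `j > 1` the poset `Q_j` consists of all
down-sets of `Q_{j-1}`, ordered by inclusion. The value at `j = 0` is a placeholder. -/
def posetQ (t m : ℕ) : ℕ → PartOrd.{0}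
  | 0 => PartOrd.of PEmpty
  | 1 => PartOrd.of (Σ _ : Fin t, Fin (m - 1))
  | j + 2 => PartOrd.of (LowerSet (posetQ t m (j + 1)))

theorem finite_lowerSet (α : Type) [PartialOrder α] [Finite α] : Finite (LowerSet α) :=
  Finite.of_injective (fun s : LowerSet α => (s : Set α)) SetLike.coe_injective

instance finite_posetQ (t m : ℕ) : ∀ j, Finite (posetQ t m j)
  | 0 => inferInstanceAs (Finite PEmpty)
  | 1 => inferInstanceAs (Finite (Σ _ : Fin t, Fin (m - 1)))
  | j + 2 =>
    haveI := finite_posetQ t m (j + 1)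
    finite_lowerSet (posetQ t m (j + 1))

/-- The number of elements of `Q_j`. -/
noncomputable def cardQ (t m j : ℕ) : ℕ := Nat.card (posetQ t m j)

/-- The size of a largest antichain in a finite poset. -/
noncomputable def maxAntichainCard (α : Type) [PartialOrder α] : ℕ :=
  sSup {n : ℕ | ∃ s : Finset α, IsAntichain (· ≤ ·) (s : Set α) ∧ s.card = n}

/-- In a finite poset the supremum is a maximum. -/
theorem isGreatest_maxAntichainCard (α : Type) [PartialOrder α] [Finite α] :
    IsGreatest {n : ℕ | ∃ s : Finset α, IsAntichain (· ≤ ·) (s : Set α) ∧ s.card = n}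
      (maxAntichainCard α) := by
  have := Fintype.ofFinite α
  have hb : BddAbove {n : ℕ | ∃ s : Finset α, IsAntichain (· ≤ ·) (s : Set α) ∧ s.card = n} := by
    refine ⟨Fintype.card α, ?_⟩
    rintro n ⟨s, -, rfl⟩
    exact s.card_le_univ
  exact ⟨Nat.sSup_mem ⟨0, ∅, by simp, rfl⟩ hb, fun n hn => le_csSup hb hn⟩

/-- The size `a_j` of a largest antichain in `Q_j`. -/
noncomputable def antichainQ (t m j : ℕ) : ℕ := maxAntichainCard (posetQ t m j)

/-!
Upper bound on the Ramsey number. Label increasing lists of vertices by elements of the posets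
`Q_j`. A list of `k - 1` vertices gets the set of pairs (color, length) of the monochromatic tight
paths that end in it, which is a down-set of `Q_1`; a shorter list `l` gets the down-set generated
by the labels of the lists `z :: l`. A single vertex thus has a label in `Q_k` (`label`). Edges whose
largest vertex is `v` only enlarge labels of lists that end in `v`, and leave labels of lists below
`v` unchanged (`label_mono`, `label_eq`).

If the edge on `y, l, v` is played and no path with `m` edges appears, the label of `l, v` is not
below that of `y, l` (`not_label_zero_le`). Going down in the length of the lists, the same relation
can be forced for shorter lists: the label of `y, l` is generated by an antichain of labels of lists
`z, y, l`, and it is enough to force the label of `y, l, v` away from each of them. Hence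
`a_2 ⋯ a_{k-1}` edges suffice to bring the label of a vertex `v` out of the set of elements below the
label of a given vertex `u < v` (`builderForces_of_label`). Vertices are treated in increasing order.
After at most `|Q_{k-1}| + 1` such steps the label of `v` differs from all earlier ones or the game
is won (`builderForces_of_vertex`), and `|Q_k| + 1` vertices cannot have distinct labels
(`builderForces_tightPath`). The two summands `1` are absorbed by the factor `a_1 = t ≥ 2`.

Estimates. Subsets of an antichain generate distinct down-sets, so `2 ^ a_j ≤ |Q_{j+1}|`
(`two_pow_antichainQ_le`); down-sets of equal size form an antichain, so
`|Q_{j+1}| ≤ a_{j+1} (|Q_j| + 1)` (`cardQ_succ_le`). Together with `m ^ t ≤ |Q_2|` these give that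
`|Q_{j+1}|` exceeds any fixed power of `|Q_j|` for `j ≥ 2` once `tm` is large
(`exists_forall_cardQ_pow_le`). Since `lg |Q_k| ≥ a_{k-1}`, for `k ≥ 4` the factors other than
`|Q_k|` are at most `a_{k-1} ^ 2` times a fixed power of `|Q_{k-2}|`, which is at most
`a_{k-1} ^ ε`. For `k = 3` the factor `|Q_2| ≤ a_2 t m` contributes `m ≤ t a_2 ^ (1 / (t - 1))`,
whence the additional exponent, and the powers of `t` are at most `a_2 ^ ε`.
-/

/-! ### Down-sets and antichains of a finite poset -/

section FinitePoset

variable {α : Type} [PartialOrder α] [Finite α]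

theorem card_le_maxAntichainCard {s : Finset α} (hs : IsAntichain (· ≤ ·) (s : Set α)) :
    s.card ≤ maxAntichainCard α :=
  (isGreatest_maxAntichainCard α).2 ⟨s, hs, rfl⟩

theorem exists_antichain_card_eq (α : Type) [PartialOrder α] [Finite α] :
    ∃ s : Finset α, IsAntichain (· ≤ ·) (s : Set α) ∧ s.card = maxAntichainCard α :=
  (isGreatest_maxAntichainCard α).1

theorem maxAntichainCard_le_card (α : Type) [PartialOrder α] [Finite α] :
    maxAntichainCard α ≤ Nat.card α := by
  have := Fintype.ofFinite α
  obtain ⟨s, -, hs⟩ := exists_antichain_card_eq α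
  rw [← hs, Nat.card_eq_fintype_card]
  exact s.card_le_univ

/-- Distinct subsets of an antichain generate distinct down-sets. -/
theorem two_pow_maxAntichainCard_le (α : Type) [PartialOrder α] [Finite α] :
    2 ^ maxAntichainCard α ≤ Nat.card (LowerSet α) := by
  have := finite_lowerSet α
  obtain ⟨s, hs, hcard⟩ := exists_antichain_card_eq α
  have hinj : Function.Injective
      (fun u : s.powerset => lowerClosure ((u : Finset α) : Set α)) := by
    have key : ∀ u v : s.powerset,
        lowerClosure ((u : Finset α) : Set α) = lowerClosure ((v : Finset α) : Set α) →
          (u : Finset α) ⊆ v := by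
      intro u v h x hx
      have hx' : x ∈ lowerClosure ((v : Finset α) : Set α) := h ▸ subset_lowerClosure hx
      obtain ⟨y, hy, hxy⟩ := mem_lowerClosure.1 hx'
      have := hs.eq (Finset.mem_powerset.1 u.2 hx) (Finset.mem_powerset.1 v.2 hy) hxy
      exact this ▸ hy
    intro u v h
    exact Subtype.ext (Finset.Subset.antisymm (key u v h) (key v u h.symm))
  calc 2 ^ maxAntichainCard α = Nat.card s.powerset := by
        rw [Nat.card_eq_fintype_card, Fintype.card_coe, Finset.card_powerset, hcard]
    _ ≤ _ := Nat.card_le_card_of_injective _ hinj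

/-- Down-sets with the same number of elements are incomparable, so the largest class of
equinumerous down-sets is an antichain. -/
theorem card_lowerSet_le (α : Type) [PartialOrder α] [Finite α] :
    Nat.card (LowerSet α) ≤ maxAntichainCard (LowerSet α) * (Nat.card α + 1) := by
  classical
  have := finite_lowerSet α
  have := Fintype.ofFinite (LowerSet α)
  rw [Nat.card_eq_fintype_card, ← Finset.card_univ, ← Finset.card_range (Nat.card α + 1)]
  refine Finset.card_le_mul_card_image_of_maps_to (f := fun s : LowerSet α => (s : Set α).ncard)
    (fun s _ => ?_) _ fun b _ => ?_
  · rw [Finset.mem_range, Nat.lt_succ_iff]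
    exact Set.ncard_le_card _
  · refine card_le_maxAntichainCard fun s hs u hu hne hle => hne ?_
    simp only [Finset.coe_filter, Finset.mem_univ, true_and, Set.mem_ofPred_eq] at hs hu
    exact SetLike.coe_injective
      (Set.eq_of_subset_of_ncard_le (LowerSet.coe_subset_coe.2 hle) (by omega) (Set.toFinite _))

theorem card_add_one_le_card_lowerSet (α : Type) [PartialOrder α] [Finite α] :
    Nat.card α + 1 ≤ Nat.card (LowerSet α) := by
  have := finite_lowerSet α
  rw [← Finite.card_option]
  refine Nat.card_le_card_of_injective
    (fun o : Option α => o.elim (⊥ : LowerSet α) LowerSet.Iic) ?_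
  have hne : ∀ a : α, LowerSet.Iic a ≠ ⊥ := fun a h => by
    have : a ∈ (⊥ : LowerSet α) := h ▸ LowerSet.mem_Iic_iff.2 le_rfl
    exact LowerSet.notMem_bot this
  rintro (_ | a) (_ | b) h
  · rfl
  · exact absurd h.symm (hne b)
  · exact absurd h (hne a)
  · exact congrArg some (LowerSet.Iic_injective h)

/-- The maximal elements among the values of `f` on `S` form an antichain that dominates all
these values. -/
theorem exists_finset_dominating {ι : Type*} (f : ι → α) (S : Set ι) :
    ∃ Z : Finset ι, ↑Z ⊆ S ∧ Z.card ≤ maxAntichainCard α ∧ ∀ i ∈ S, ∃ z ∈ Z, f i ≤ f z := by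
  classical
  have := Fintype.ofFinite α
  set A : Finset α := Finset.univ.filter fun a => Maximal (· ∈ f '' S) a with hA
  have hA' : ∀ a ∈ A, Maximal (· ∈ f '' S) a := fun a ha => (Finset.mem_filter.1 ha).2
  choose g hgS hg using fun a : A => (hA' a a.2).1
  refine ⟨Finset.univ.image g, ?_, ?_, fun i hi => ?_⟩
  · intro i hi
    obtain ⟨a, -, rfl⟩ := Finset.mem_image.1 (Finset.mem_coe.1 hi)
    exact hgS a
  · refine Finset.card_image_le.trans ?_
    rw [Finset.card_univ, Fintype.card_coe]
    refine card_le_maxAntichainCard fun a ha b hb hne hle => hne ?_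
    exact (hA' a ha).eq_of_le (hA' b hb).1 hle
  · obtain ⟨a, hia, ha⟩ := (Set.toFinite (f '' S)).exists_le_maximal ⟨i, hi, rfl⟩
    have haA : a ∈ A := by simpa [hA] using ha
    exact ⟨g ⟨a, haA⟩, Finset.mem_image_of_mem g (Finset.mem_univ _),
      (hg ⟨a, haA⟩).symm ▸ hia⟩

end FinitePoset

/-! ### Positions of the game -/

section Game

variable {k t : ℕ} {V : Type}

/-- The position `c'` arises from `c` by playing only edges that contain the vertex `v`. -/
def ExtendsAt (v : V) (c c' : Position t V) : Prop :=
  ∀ e, c' e ≠ c e → v ∈ e ∧ c e = none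

theorem ExtendsAt.refl (v : V) (c : Position t V) : ExtendsAt v c c := fun _ h => absurd rfl h

theorem ExtendsAt.trans {v : V} {c c' c'' : Position t V} (h : ExtendsAt v c c')
    (h' : ExtendsAt v c' c'') : ExtendsAt v c c'' := by
  intro e he
  by_cases h1 : c' e = c e
  · have := h' e (h1.symm ▸ he)
    exact ⟨this.1, h1 ▸ this.2⟩
  · exact h e h1

theorem ExtendsAt.update [DecidableEq (Finset V)] {v : V} {c : Position t V} {e : Finset V}
    (hv : v ∈ e) (hc : c e = none) (i : Fin t) :
    ExtendsAt v c (Function.update c e (some i)) := by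
  intro e' he'
  by_cases h : e' = e
  · exact h ▸ ⟨hv, hc⟩
  · exact absurd (Function.update_of_ne h _ _) he'

theorem ExtendsAt.eq_some {v : V} {c c' : Position t V} (h : ExtendsAt v c c') {e : Finset V}
    {i : Fin t} (he : c e = some i) : c' e = some i := by
  by_contra h1
  have := (h e (he ▸ h1)).2
  simp [he] at this

theorem ExtendsAt.eq_of_notMem {v : V} {c c' : Position t V} (h : ExtendsAt v c c')
    {e : Finset V} (he : v ∉ e) : c' e = c e := by
  by_contra h1
  exact he (h e h1).1

variable {W : Type} [LinearOrder W] [LinearOrder V]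

theorem builderForces_of_hasMonoCopy {G : UniformHypergraph k W} {c : Position t V}
    (h : HasMonoCopy G c) : ∀ N, BuilderForces G N c
  | 0 => h
  | _ + 1 => Or.inl h

theorem BuilderForces.mono {G : UniformHypergraph k W} {N M : ℕ} (hNM : N ≤ M)
    {c : Position t V} (h : BuilderForces G N c) : BuilderForces G M c := by
  induction N generalizing M c with
  | zero => exact builderForces_of_hasMonoCopy h M
  | succ N ih =>
    obtain ⟨M, rfl⟩ : ∃ M', M = M' + 1 := ⟨M - 1, by omega⟩
    rcases h with h | ⟨e, he, hc, h⟩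
    · exact Or.inl h
    · exact Or.inr ⟨e, he, hc, fun i => ih (by omega) (h i)⟩

/-! ### Monochromatic tight paths and labels -/

/-- There is a tight path with `n` edges, all of color `i`, whose last `l.length` vertices are
the entries of `l`. Its edges have `l.length + 1` vertices, and vertices are listed in increasing
order. -/
def EndsPath (c : Position t V) (i : Fin t) (n : ℕ) (l : List V) : Prop :=
  ∃ w : List V, w.Pairwise (· < ·) ∧ l <:+ w ∧ w.length = n + l.length ∧
    ∀ u, u <:+: w → u.length = l.length + 1 → c u.toFinset = some i

theorem EndsPath.zero {c : Position t V} (i : Fin t) {l : List V} (hl : l.Pairwise (· < ·)) :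
    EndsPath c i 0 l :=
  ⟨l, hl, List.suffix_rfl, by simp, fun u hu h => by have := hu.length_le; omega⟩

theorem EndsPath.mono {c : Position t V} {i : Fin t} {n n' : ℕ} {l : List V}
    (h : EndsPath c i n l) (hn : n' ≤ n) : EndsPath c i n' l := by
  obtain ⟨w, hw, hlw, hlen, hc⟩ := h
  have hsuf : w.drop (n - n') <:+ w := List.drop_suffix _ _
  refine ⟨w.drop (n - n'), hw.sublist hsuf.sublist, ?_, ?_,
    fun u hu => hc u (hu.trans hsuf.isInfix)⟩
  · exact List.suffix_of_suffix_length_le hlw hsuf (by rw [List.length_drop]; omega)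
  · rw [List.length_drop]; omega

/-- A path that ends in `y :: l` is prolonged by the edge `y :: (l ++ [v])`. -/
theorem EndsPath.concat {c : Position t V} {i : Fin t} {n : ℕ} {y v : V} {l : List V}
    (h : EndsPath c i n (y :: l)) (hs : (y :: (l ++ [v])).Pairwise (· < ·))
    (hc : c (y :: (l ++ [v])).toFinset = some i) : EndsPath c i (n + 1) (l ++ [v]) := by
  obtain ⟨w, hw, ⟨p, rfl⟩, hlen, hcw⟩ := h
  have hsuf : l ++ [v] <:+ (p ++ y :: l) ++ [v] := ⟨p ++ [y], by simp⟩
  have hsuf' : y :: (l ++ [v]) <:+ (p ++ y :: l) ++ [v] := ⟨p, by simp⟩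
  refine ⟨(p ++ y :: l) ++ [v], ?_, hsuf, ?_, fun u hu hul => ?_⟩
  · rw [List.pairwise_append]
    refine ⟨hw, by simp, fun a ha b hb => ?_⟩
    obtain rfl : b = v := by simpa using hb
    have hyl : ∀ x ∈ y :: l, x < b := fun x hx =>
      (List.pairwise_append.1 (show (y :: l ++ [b]).Pairwise (· < ·) from hs)).2.2 x hx b (by simp)
    rcases List.mem_append.1 ha with ha | ha
    · exact ((List.pairwise_append.1 hw).2.2 a ha y (by simp)).trans (hyl y (by simp))
    · exact hyl a ha
  · simp at hlen ⊢; omega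
  · simp only [List.length_append, List.length_cons, List.length_nil] at hul
    rcases List.infix_concat_iff.1 hu with hu | hu
    · have : u = y :: (l ++ [v]) :=
        (List.suffix_of_suffix_length_le hu hsuf' (by simp; omega)).eq_of_length (by simp; omega)
      rw [this, hc]
    · exact hcw u hu (by simpa using hul)

theorem EndsPath.extend {v : V} {c c' : Position t V} (h : ExtendsAt v c c') {i : Fin t} {n : ℕ}
    {l : List V} (hp : EndsPath c i n l) : EndsPath c' i n l := by
  obtain ⟨w, hw, hlw, hlen, hc⟩ := hp
  exact ⟨w, hw, hlw, hlen, fun u hu hul => h.eq_some (hc u hu hul)⟩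

theorem notMem_of_suffix {v : V} {l w : List V} (hw : w.Pairwise (· < ·)) (hlw : l <:+ w)
    (hl : l ≠ []) (hv : ∀ x ∈ l, x < v) : v ∉ w := by
  obtain ⟨p, rfl⟩ := hlw
  intro hvw
  obtain ⟨x, hx⟩ := List.exists_mem_of_ne_nil l hl
  rcases List.mem_append.1 hvw with h | h
  · exact absurd (hv x hx) ((List.pairwise_append.1 hw).2.2 v h x hx).not_gt
  · exact lt_irrefl v (hv v h)

/-- A path that ends before `v` is not affected by edges that contain `v`. -/
theorem EndsPath.of_extend {v : V} {c c' : Position t V} (h : ExtendsAt v c c') {i : Fin t}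
    {n : ℕ} {l : List V} (hl : l ≠ []) (hv : ∀ x ∈ l, x < v) (hp : EndsPath c' i n l) :
    EndsPath c i n l := by
  obtain ⟨w, hw, hlw, hlen, hc⟩ := hp
  refine ⟨w, hw, hlw, hlen, fun u hu hul => ?_⟩
  rw [← hc u hu hul]
  refine (h.eq_of_notMem fun hvu => ?_).symm
  exact notMem_of_suffix hw hlw hl hv (hu.subset (List.mem_toFinset.1 hvu))

theorem EndsPath.hasMonoCopy {c : Position t V} {i : Fin t} {n : ℕ} {l : List V} {r : ℕ}
    (h : EndsPath c i n l) (hl : l.length + 1 = k) (hr : r = n + l.length) :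
    HasMonoCopy (tightPath k r) c := by
  obtain ⟨w, hw, hlw, hlen, hc⟩ := h
  obtain rfl : r = w.length := by omega
  have hmono : StrictMono w.get := fun a b hab => List.pairwise_iff_get.1 hw a b hab
  refine ⟨OrderEmbedding.ofStrictMono _ hmono, i, ?_⟩
  rintro e ⟨j, hj, rfl⟩
  have hinf : (w.drop j).take k <:+: w :=
    (List.take_prefix _ _).isInfix.trans (List.drop_suffix _ _).isInfix
  rw [← hc _ hinf (by rw [List.length_take, List.length_drop]; omega)]
  congr 1
  ext x
  simp only [consecutive, Finset.mem_map, Finset.mem_filter, Finset.mem_univ, true_and,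
    List.mem_toFinset]
  constructor
  · rintro ⟨a, ⟨ha, ha'⟩, rfl⟩
    rw [List.mem_iff_getElem]
    refine ⟨a - j, by rw [List.length_take, List.length_drop]; omega, ?_⟩
    simp only [List.getElem_take, List.getElem_drop]
    simp [OrderEmbedding.ofStrictMono, Nat.add_sub_cancel' ha]
  · intro hx
    obtain ⟨b, hb, rfl⟩ := List.mem_iff_getElem.1 hx
    rw [List.length_take, List.length_drop] at hb
    refine ⟨⟨j + b, by omega⟩, ⟨by simp, by simp; omega⟩, ?_⟩
    simp [OrderEmbedding.ofStrictMono, List.getElem_take, List.getElem_drop]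

/-- The label of an increasing list `l` of vertices: a down-set of `Q_{s+1}`, that is, an element
of `Q_{s+2}`. For `s = 0` it consists of the pairs `(i, j)` such that a path with `j + 1` edges,
all of color `i`, ends in `l`. For larger `s` it is the down-set generated by the labels of the
lists that arise from `l` by prepending a vertex. In the game with edges of size `k` it is used
for lists of length `k - 1 - s`. -/
def label (m : ℕ) (c : Position t V) : (s : ℕ) → List V → LowerSet (posetQ t m (s + 1))
  | 0, l =>
    { carrier := {x : Σ _ : Fin t, Fin (m - 1) | EndsPath c x.1 (x.2 + 1) l}
      lower' := by
        rintro ⟨i, a⟩ b (hab : b ≤ (⟨i, a⟩ : Σ _ : Fin t, Fin (m - 1))) h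
        cases hab with
        | fiber i b a hba => exact EndsPath.mono h (Nat.succ_le_succ hba) }
  | s + 1, l =>
    { carrier := {q : LowerSet (posetQ t m (s + 1)) |
        ∃ z, (z :: l).Pairwise (· < ·) ∧ q ≤ label m c s (z :: l)}
      lower' := by
        rintro a b hba ⟨z, hz, h⟩
        exact ⟨z, hz, le_trans hba h⟩ }

theorem mem_label_zero {m : ℕ} {c : Position t V} {l : List V} {i : Fin t} {j : Fin (m - 1)} :
    ((⟨i, j⟩ : Σ _ : Fin t, Fin (m - 1)) : posetQ t m 1) ∈ label m c 0 l ↔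
      EndsPath c i (j + 1) l :=
  Iff.rfl

theorem mem_label_succ {m s : ℕ} {c : Position t V} {l : List V}
    {q : LowerSet (posetQ t m (s + 1))} :
    (q : posetQ t m (s + 2)) ∈ label m c (s + 1) l ↔
      ∃ z, (z :: l).Pairwise (· < ·) ∧ q ≤ label m c s (z :: l) :=
  Iff.rfl

theorem label_mono {m : ℕ} {v : V} {c c' : Position t V} (h : ExtendsAt v c c') (s : ℕ)
    (l : List V) : label m c s l ≤ label m c' s l := by
  induction s generalizing l with
  | zero => exact fun x hx => EndsPath.extend h hx
  | succ s ih => exact fun q ⟨z, hz, hq⟩ => ⟨z, hz, hq.trans (ih _)⟩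

/-- Edges that contain `v` do not change the labels of lists of vertices below `v`. -/
theorem label_eq {m : ℕ} {v : V} {c c' : Position t V} (h : ExtendsAt v c c') (s : ℕ)
    {l : List V} (hl : l ≠ []) (hv : ∀ x ∈ l, x < v) : label m c' s l = label m c s l := by
  refine le_antisymm ?_ (label_mono h s l)
  induction s generalizing l with
  | zero => exact fun x hx => EndsPath.of_extend h hl hv hx
  | succ s ih =>
    rintro q ⟨z, hz, hq⟩
    obtain ⟨x, hx⟩ := List.exists_mem_of_ne_nil l hl
    refine ⟨z, hz, hq.trans (ih (by simp) ?_)⟩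
    rintro a (_ | ⟨_, ha⟩)
    · exact ((List.pairwise_cons.1 hz).1 x hx).trans (hv x hx)
    · exact hv a ha

/-- As long as there is no monochromatic path with `m` edges, an edge with vertices
`y :: (l ++ [v])` puts a new element into the label of `l ++ [v]`. -/
theorem not_label_zero_le {m : ℕ} {c : Position t V} {y v : V} {l : List V} {i : Fin t}
    (hm : 2 ≤ m) (hs : (y :: (l ++ [v])).Pairwise (· < ·))
    (hc : c (y :: (l ++ [v])).toFinset = some i) (hno : ¬ EndsPath c i m (l ++ [v])) :
    ¬ label m c 0 (l ++ [v]) ≤ label m c 0 (y :: l) := by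
  intro hle
  have hyl : (y :: l).Pairwise (· < ·) := hs.sublist (by simp)
  have key : ∀ n ≤ m - 1, EndsPath c i n (y :: l) := by
    intro n
    induction n with
    | zero => exact fun _ => EndsPath.zero i hyl
    | succ n ih =>
      intro hn
      have : EndsPath c i (n + 1) (l ++ [v]) := (ih (by omega)).concat hs hc
      exact mem_label_zero.1 (hle ((mem_label_zero (j := ⟨n, by omega⟩)).2 this))
  have := (key (m - 1) le_rfl).concat hs hc
  rw [Nat.sub_add_cancel (by omega)] at this
  exact hno this

/-! ### Builder's strategy -/

/-- The number of edges that Builder needs to enlarge a label of index `s`. -/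
noncomputable def forcingCost (t m s : ℕ) : ℕ := ∏ i ∈ Finset.Icc 2 (s + 1), antichainQ t m i

theorem forcingCost_zero (t m : ℕ) : forcingCost t m 0 = 1 := by simp [forcingCost]

theorem forcingCost_succ (t m s : ℕ) :
    forcingCost t m (s + 1) = antichainQ t m (s + 2) * forcingCost t m s := by
  rw [forcingCost, Finset.prod_Icc_succ_top (by omega), mul_comm, forcingCost]

/-- Builder can force the label of `l ++ [v]` not to lie below that of `y :: l`. For `s = 0` one
edge is enough. For larger `s` it suffices that the label of `y :: (l ++ [v])` is not below the
label of any `z :: y :: l`; only the vertices `z` for which the latter label is maximal matter, and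
those labels form an antichain. The rest of the game is described by the hypothesis `hwin`. -/
theorem builderForces_of_label {m : ℕ} (hm : 2 ≤ m) {v : V} (s : ℕ) {y : V} {l : List V}
    {c : Position t V} {N : ℕ} (hs : (y :: (l ++ [v])).Pairwise (· < ·))
    (hk : l.length + 2 + s = k)
    (hwin : ∀ c', ExtendsAt v c c' → ¬ label m c' s (l ++ [v]) ≤ label m c' s (y :: l) →
      BuilderForces (tightPath k (k + m - 1)) N c') :
    BuilderForces (tightPath k (k + m - 1)) (N + forcingCost t m s) c := by
  induction s generalizing y l c N with
  | zero =>
    have hplayed : ∀ c' i, ExtendsAt v c c' → c' (y :: (l ++ [v])).toFinset = some i →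
        BuilderForces (tightPath k (k + m - 1)) N c' := by
      intro c' i hext hc'
      by_cases hp : EndsPath c' i m (l ++ [v])
      · exact builderForces_of_hasMonoCopy
          (hp.hasMonoCopy (by simp; omega) (by simp; omega)) N
      · exact hwin c' hext (not_label_zero_le hm hs hc' hp)
    rw [forcingCost_zero]
    rcases hc : c (y :: (l ++ [v])).toFinset with _ | i
    · refine Or.inr ⟨_, ?_, hc, fun i => hplayed _ i (ExtendsAt.update (by simp) hc i) (by simp)⟩
      rw [List.toFinset_card_of_nodup (hs.imp ne_of_lt)]
      simp; omega
    · exact (hplayed c i (ExtendsAt.refl v c) hc).mono (Nat.le_succ N)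
  | succ s ih =>
    have hyl : ∀ x ∈ y :: l, x < v := fun x hx =>
      (List.pairwise_append.1 (show (y :: l ++ [v]).Pairwise (· < ·) from hs)).2.2 x hx v (by simp)
    have hfix : ∀ {c₁ c₂ : Position t V}, ExtendsAt v c₁ c₂ →
        ∀ {z}, (z :: y :: l).Pairwise (· < ·) →
        label m c₂ s (z :: y :: l) = label m c₁ s (z :: y :: l) := by
      intro c₁ c₂ hext z hz
      refine label_eq hext s (by simp) ?_
      rintro x (_ | ⟨_, hx⟩)
      · exact ((List.pairwise_cons.1 hz).1 y (by simp)).trans (hyl y (by simp))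
      · exact hyl x hx
    obtain ⟨Z, hZS, hZcard, hZ⟩ := exists_finset_dominating (α := posetQ t m (s + 2))
      (fun z => label m c s (z :: y :: l)) {z | (z :: y :: l).Pairwise (· < ·)}
    -- Builder treats the vertices `z ∈ Z` one after the other.
    have hloop : ∀ Z' ⊆ Z, ∀ c₁ N, ExtendsAt v c c₁ →
        (∀ c', ExtendsAt v c₁ c' →
          (∀ z ∈ Z', ¬ label m c' s (y :: (l ++ [v])) ≤ label m c' s (z :: y :: l)) →
            BuilderForces (tightPath k (k + m - 1)) N c') →
        BuilderForces (tightPath k (k + m - 1)) (N + Z'.card * forcingCost t m s) c₁ := by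
      intro Z'
      induction Z' using Finset.induction_on with
      | empty => exact fun _ c₁ N _ h => by simpa using h c₁ (ExtendsAt.refl v c₁) (by simp)
      | insert z Z' hzZ' ihZ =>
        intro hsub c₁ N hc₁ h
        rw [Finset.card_insert_of_notMem hzZ',
          show N + (Z'.card + 1) * forcingCost t m s
            = N + forcingCost t m s + Z'.card * forcingCost t m s by ring]
        refine ihZ ((Finset.subset_insert _ _).trans hsub) c₁ _ hc₁ fun c₂ hc₂ hZ₂ => ?_
        have hz : (z :: y :: l).Pairwise (· < ·) := hZS (hsub (Finset.mem_insert_self _ _))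
        have hzs : (z :: ((y :: l) ++ [v])).Pairwise (· < ·) := by
          refine List.pairwise_cons.2 ⟨fun x hx => ?_, hs⟩
          have hzy := (List.pairwise_cons.1 hz).1 y (by simp)
          rcases List.mem_append.1 hx with hx | hx
          · exact (List.pairwise_cons.1 hz).1 x hx
          · obtain rfl : x = v := by simpa using hx
            exact hzy.trans (hyl y (by simp))
        refine ih hzs (by simp; omega) fun c₃ hc₃ hz₃ => h c₃ (hc₂.trans hc₃) fun z' hz' => ?_
        rcases Finset.mem_insert.1 hz' with rfl | hz''
        · exact hz₃
        · intro hle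
          rw [hfix hc₃ (hZS (hsub hz'))] at hle
          exact hZ₂ z' hz'' ((label_mono hc₃ s _).trans hle)
    rw [forcingCost_succ]
    refine (hloop Z subset_rfl c N (ExtendsAt.refl v c) fun c' hc' hZ' =>
      hwin c' hc' fun hle => ?_).mono (Nat.add_le_add_left (Nat.mul_le_mul_right _ hZcard) N)
    obtain ⟨z, hz, hle'⟩ := mem_label_succ.1 (hle (mem_label_succ.2 ⟨y, hs, le_rfl⟩))
    obtain ⟨z', hz'Z, hzz'⟩ := hZ z hz
    refine hZ' z' hz'Z (hle'.trans ?_)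
    rw [hfix hc' hz, hfix hc' (hZS hz'Z)]
    exact hzz'

/-- Builder can force the label of the vertex `v` to differ from the labels of all smaller
vertices: each time it agrees with one of them, Builder enlarges it. The number `d` of attempts has
to exceed the number of elements missing from the label, since even the full label may agree with
an earlier one; in that case the next attempt wins the game. -/
theorem builderForces_of_vertex {m : ℕ} (hm : 2 ≤ m) {v : V} {s : ℕ} (hk : s + 2 = k) (d : ℕ)
    {c : Position t V} {N : ℕ}
    (hd : cardQ t m (s + 1) < (label m c s [v] : Set (posetQ t m (s + 1))).ncard + d)
    (hwin : ∀ c', ExtendsAt v c c' → (∀ u < v, label m c' s [u] ≠ label m c' s [v]) →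
      BuilderForces (tightPath k (k + m - 1)) N c') :
    BuilderForces (tightPath k (k + m - 1)) (N + d * forcingCost t m s) c := by
  induction d generalizing c with
  | zero =>
    have := Set.ncard_le_card (label m c s [v] : Set (posetQ t m (s + 1)))
    rw [cardQ] at hd
    omega
  | succ d ih =>
    by_cases h : ∃ u < v, label m c s [u] = label m c s [v]
    · obtain ⟨u, huv, hu⟩ := h
      rw [show N + (d + 1) * forcingCost t m s
        = N + d * forcingCost t m s + forcingCost t m s by ring]
      refine builderForces_of_label hm s (l := []) (y := u) (v := v) (by simpa using huv)
        (by simp; omega) fun c' hc' hnot => ih ?_ fun c'' hc'' => hwin c'' (hc'.trans hc'')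
      rw [List.nil_append, label_eq (l := [u]) hc' s (by simp) (by simpa using huv), hu] at hnot
      have hlt : label m c s [v] < label m c' s [v] :=
        lt_of_le_not_ge (label_mono hc' s _) hnot
      have := Set.ncard_lt_ncard (LowerSet.coe_ssubset_coe.2 hlt) (Set.toFinite _)
      omega
    · push Not at h
      exact (hwin c (ExtendsAt.refl v c) h).mono (Nat.le_add_right _ _)

end Game

/-- On `|Q_k| + 1` vertices Builder makes the labels of all vertices distinct, unless a
monochromatic path appears before. -/
theorem builderForces_tightPath {t m k s : ℕ} (hm : 2 ≤ m) (hk : s + 2 = k) :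
    BuilderForces (tightPath k (k + m - 1))
      ((cardQ t m k + 1) * ((cardQ t m (s + 1) + 1) * forcingCost t m s))
      (fun _ => none : Position t (Fin (cardQ t m k + 1))) := by
  subst hk
  set n := cardQ t m (s + 2) + 1 with hn
  have key : ∀ (p j : ℕ) (c : Position t (Fin n)), j + p = n →
      (∀ u v : Fin n, u < v → (v : ℕ) < j → label m c s [u] ≠ label m c s [v]) →
      BuilderForces (tightPath (s + 2) (s + 2 + m - 1))
        (p * ((cardQ t m (s + 1) + 1) * forcingCost t m s)) c := by
    intro p
    induction p with
    | zero =>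
      intro j c hj hne
      have hinj : Function.Injective fun u : Fin n => (label m c s [u] : posetQ t m (s + 2)) := by
        intro u v huv
        by_contra h
        rcases lt_or_gt_of_ne h with h | h
        · exact hne u v h (by omega) huv
        · exact hne v u h (by omega) huv.symm
      have hle : Nat.card (Fin n) ≤ cardQ t m (s + 2) := Nat.card_le_card_of_injective _ hinj
      rw [Nat.card_eq_fintype_card, Fintype.card_fin] at hle
      omega
    | succ p ih =>
      intro j c hj hne
      rw [Nat.succ_mul]
      refine builderForces_of_vertex hm (v := ⟨j, by omega⟩) rfl _ (by omega)
        fun c' hc' hv => ih (j + 1) c' (by omega) fun u w huw hw => ?_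
      rcases Nat.lt_succ_iff_lt_or_eq.1 hw with hw | hw
      · have hlt : ∀ x : Fin n, (x : ℕ) < j → ∀ y ∈ [x], y < (⟨j, by omega⟩ : Fin n) := by
          intro x hx y hy
          obtain rfl : y = x := by simpa using hy
          exact hx
        rw [label_eq hc' s (by simp) (hlt u ((Fin.lt_def.1 huw).trans hw)),
          label_eq hc' s (by simp) (hlt w hw)]
        exact hne u w huw hw
      · subst hw
        exact hv u huw
  exact key n 0 _ (by omega) fun u v _ hv => absurd hv (Nat.not_lt_zero _)

/-! ### Sizes and widths of the posets `Q_j` -/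

theorem cardQ_add_one_le {t m j : ℕ} (hj : 1 ≤ j) : cardQ t m j + 1 ≤ cardQ t m (j + 1) := by
  obtain ⟨j, rfl⟩ := Nat.exists_eq_add_of_le' hj
  exact card_add_one_le_card_lowerSet (posetQ t m (j + 1))

theorem two_pow_antichainQ_le {t m j : ℕ} (hj : 1 ≤ j) :
    2 ^ antichainQ t m j ≤ cardQ t m (j + 1) := by
  obtain ⟨j, rfl⟩ := Nat.exists_eq_add_of_le' hj
  exact two_pow_maxAntichainCard_le (posetQ t m (j + 1))

theorem cardQ_succ_le {t m j : ℕ} (hj : 1 ≤ j) :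
    cardQ t m (j + 1) ≤ antichainQ t m (j + 1) * (cardQ t m j + 1) := by
  obtain ⟨j, rfl⟩ := Nat.exists_eq_add_of_le' hj
  exact card_lowerSet_le (posetQ t m (j + 1))

theorem antichainQ_le_cardQ (t m j : ℕ) : antichainQ t m j ≤ cardQ t m j :=
  maxAntichainCard_le_card _

theorem cardQ_one (t m : ℕ) : cardQ t m 1 = t * (m - 1) := by
  change Nat.card (Σ _ : Fin t, Fin (m - 1)) = _
  simp

theorem cardQ_mono {t m i j : ℕ} (hi : 1 ≤ i) (hij : i ≤ j) : cardQ t m i ≤ cardQ t m j := by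
  induction j, hij using Nat.le_induction with
  | base => exact le_rfl
  | succ j hij ih => exact ih.trans ((Nat.le_succ _).trans (cardQ_add_one_le (hi.trans hij)))

theorem two_le_cardQ {t m j : ℕ} (hm : 2 ≤ m) (ht : 2 ≤ t) (hj : 1 ≤ j) : 2 ≤ cardQ t m j := by
  refine le_trans ?_ (cardQ_mono le_rfl hj)
  rw [cardQ_one]
  exact ht.trans (Nat.le_mul_of_pos_right t (by omega))

theorem antichainQ_one_le (t m : ℕ) : antichainQ t m 1 ≤ t := by
  obtain ⟨s, hs, hcard⟩ := exists_antichain_card_eq (posetQ t m 1)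
  rw [antichainQ, ← hcard]
  let f : posetQ t m 1 → Fin t := fun x => (show Σ _ : Fin t, Fin (m - 1) from x).1
  have hf : Set.InjOn f (s : Set (posetQ t m 1)) := by
    rintro ⟨i, a⟩ ha ⟨i', b⟩ hb (rfl : i = i')
    have hle : ∀ {a b : Fin (m - 1)}, a ≤ b →
        (⟨i, a⟩ : Σ _ : Fin t, Fin (m - 1)) ≤ (⟨i, b⟩ : Σ _ : Fin t, Fin (m - 1)) :=
      fun h => Sigma.LE.fiber i _ _ h
    rcases le_total (α := Fin (m - 1)) a b with h | h
    · exact hs.eq ha hb (hle h)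
    · exact (hs.eq hb ha (hle h)).symm
  calc s.card ≤ (Finset.univ : Finset (Fin t)).card :=
        Finset.card_le_card_of_injOn f (fun _ _ => Finset.mem_univ _) hf
    _ = t := by simp

theorem le_antichainQ_one {t m : ℕ} (hm : 2 ≤ m) : t ≤ antichainQ t m 1 := by
  let f : Fin t ↪ posetQ t m 1 :=
    ⟨fun i => (⟨i, ⟨0, by omega⟩⟩ : Σ _ : Fin t, Fin (m - 1)), fun i j h => congrArg Sigma.fst h⟩
  have hanti : IsAntichain (· ≤ ·)
      ((Finset.univ.map f : Finset (posetQ t m 1)) : Set (posetQ t m 1)) := by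
    intro a ha b hb hne hle
    obtain ⟨i, -, rfl⟩ := Finset.mem_map.1 (Finset.mem_coe.1 ha)
    obtain ⟨j, -, rfl⟩ := Finset.mem_map.1 (Finset.mem_coe.1 hb)
    obtain ⟨h, -⟩ := Sigma.le_def.1 hle
    exact hne (congrArg f h)
  simpa [antichainQ] using card_le_maxAntichainCard hanti

/-- A vector in `{0, …, m - 1}^t` gives the down-set of `Q_1` with the prescribed number of
elements in each chain. -/
theorem pow_le_cardQ_two (t m : ℕ) : m ^ t ≤ cardQ t m 2 := by
  let F : (Fin t → Fin m) → LowerSet (posetQ t m 1) := fun f =>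
    { carrier := {x : Σ _ : Fin t, Fin (m - 1) | (x.2 : ℕ) < f x.1}
      lower' := by
        rintro ⟨i, a⟩ b (hab : b ≤ (⟨i, a⟩ : Σ _ : Fin t, Fin (m - 1))) h
        cases hab with
        | fiber i b a hba => exact lt_of_le_of_lt (Fin.le_def.1 hba) h }
  have hF : ∀ f i (a : Fin (m - 1)),
      ((⟨i, a⟩ : Σ _ : Fin t, Fin (m - 1)) : posetQ t m 1) ∈ F f ↔ (a : ℕ) < f i :=
    fun f i a => Iff.rfl
  have hle : ∀ f g, F f ≤ F g → ∀ i, f i ≤ g i := by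
    intro f g h i
    by_contra hlt
    rw [not_le, Fin.lt_def] at hlt
    have hm : (g i : ℕ) < m - 1 := by have := (f i).2; omega
    exact lt_irrefl _ ((hF g i ⟨g i, hm⟩).1 (h ((hF f i ⟨g i, hm⟩).2 hlt)))
  have hinj : Function.Injective F := fun f g h =>
    funext fun i => le_antisymm (hle f g h.le i) (hle g f h.ge i)
  have : Nat.card (Fin t → Fin m) ≤ cardQ t m 2 :=
    have := finite_posetQ t m 2
    Nat.card_le_card_of_injective (β := posetQ t m 2) F hinj
  simpa using this

/-! ### Growth of the sequence `|Q_j|` -/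

theorem exists_forall_pow_le_two_pow (C : ℕ) : ∃ X : ℕ, ∀ a, X ≤ a → a ^ C ≤ 2 ^ a := by
  have h := tendsto_pow_const_div_const_pow_of_one_lt C (r := (2 : ℝ)) (by norm_num)
  obtain ⟨X, hX⟩ := Filter.eventually_atTop.1 (h.eventually_le_const zero_lt_one)
  refine ⟨X, fun a ha => ?_⟩
  have := hX a ha
  rw [div_le_one (by positivity)] at this
  exact_mod_cast this

theorem exists_forall_pow_le_pow_sub_one (K : ℕ) :
    ∃ M : ℕ, ∀ m t : ℕ, 2 ≤ m → 2 ≤ t → M ≤ t * m → t ^ K ≤ m ^ (t - 1) := by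
  obtain ⟨T, hT⟩ := exists_forall_pow_le_two_pow (K + 1)
  refine ⟨T * T ^ K, fun m t hm ht h => ?_⟩
  rcases le_or_gt T t with hTt | hTt
  · -- For large `t` already the base `2` is enough.
    have h1 : 2 * t ^ K ≤ 2 * 2 ^ (t - 1) := by
      calc 2 * t ^ K ≤ t * t ^ K := Nat.mul_le_mul_right _ ht
        _ = t ^ (K + 1) := (pow_succ' t K).symm
        _ ≤ 2 ^ t := hT t hTt
        _ = 2 * 2 ^ (t - 1) := by rw [← pow_succ', Nat.sub_add_cancel (by omega)]
    exact (Nat.le_of_mul_le_mul_left h1 two_pos).trans (Nat.pow_le_pow_left hm _)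
  · -- For bounded `t` the factor `m` is large.
    have h1 : T ^ K ≤ m := by
      by_contra hlt
      exact absurd h (not_le.2 (Nat.mul_lt_mul'' hTt (not_le.1 hlt)))
    calc t ^ K ≤ T ^ K := Nat.pow_le_pow_left hTt.le K
      _ ≤ m := h1
      _ ≤ m ^ (t - 1) := Nat.le_self_pow (by omega) m

theorem cardQ_one_add_one_le {t m : ℕ} (hm : 2 ≤ m) (ht : 2 ≤ t) : cardQ t m 1 + 1 ≤ t * m := by
  obtain ⟨n, rfl⟩ := Nat.exists_eq_add_of_le' (show 1 ≤ m by omega)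
  rw [cardQ_one, Nat.add_sub_cancel, Nat.mul_succ]
  omega

/-- If `tm` is large, then, from `Q_2` on, the width of `Q_j` is at least the fourth root of its
size, and therefore `|Q_{j+1}|` exceeds any prescribed power of `|Q_j|`. -/
theorem exists_forall_cardQ_pow_le {C : ℕ} (hC : 4 ≤ C) :
    ∃ M : ℕ, ∀ m t : ℕ, 2 ≤ m → 2 ≤ t → M ≤ t * m → ∀ j, 2 ≤ j →
      cardQ t m j ≤ antichainQ t m j ^ 4 ∧ cardQ t m j ^ C ≤ cardQ t m (j + 1) := by
  obtain ⟨X, hX⟩ := exists_forall_pow_le_two_pow (4 * C)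
  obtain ⟨M, hM⟩ := exists_forall_pow_le_pow_sub_one 4
  refine ⟨max M (X ^ 4), fun m t hm ht htm => ?_⟩
  have hbase : (t * m) ^ 4 ≤ cardQ t m 2 ^ 3 := by
    calc (t * m) ^ 4 = t ^ 4 * m ^ 4 := mul_pow _ _ _
      _ ≤ m ^ (t - 1) * m ^ 4 := Nat.mul_le_mul_right _ (hM m t hm ht ((le_max_left _ _).trans htm))
      _ = m ^ (t - 1 + 4) := (pow_add _ _ _).symm
      _ ≤ m ^ (t * 3) := Nat.pow_le_pow_right (by omega) (by omega)
      _ = (m ^ t) ^ 3 := pow_mul _ _ _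
      _ ≤ cardQ t m 2 ^ 3 := Nat.pow_le_pow_left (pow_le_cardQ_two t m) 3
  have htm2 : t * m ≤ cardQ t m 2 := by
    refine le_of_pow_le_pow_left₀ (n := 4) (by norm_num) (Nat.zero_le _) (hbase.trans ?_)
    exact Nat.pow_le_pow_right (by have := two_le_cardQ hm ht (j := 2) (by omega); omega) (by omega)
  -- The hypothesis on `|Q_j|` says that `Q_{j+1}` has few ranks in comparison to its size.
  have hstep : ∀ j, 1 ≤ j → (cardQ t m j + 1) ^ 4 ≤ cardQ t m (j + 1) ^ 3 →
      cardQ t m (j + 1) ≤ antichainQ t m (j + 1) ^ 4 ∧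
        cardQ t m (j + 1) ^ C ≤ cardQ t m (j + 2) := by
    intro j hj h
    have hpos : 0 < cardQ t m (j + 1) := by
      have := two_le_cardQ hm ht (j := j + 1) (by omega); omega
    have h1 : cardQ t m (j + 1) ≤ antichainQ t m (j + 1) ^ 4 := by
      refine Nat.le_of_mul_le_mul_right ?_ (pow_pos hpos 3)
      calc cardQ t m (j + 1) * cardQ t m (j + 1) ^ 3 = cardQ t m (j + 1) ^ 4 := by ring
        _ ≤ (antichainQ t m (j + 1) * (cardQ t m j + 1)) ^ 4 :=
          Nat.pow_le_pow_left (cardQ_succ_le hj) 4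
        _ = antichainQ t m (j + 1) ^ 4 * (cardQ t m j + 1) ^ 4 := mul_pow _ _ _
        _ ≤ _ := Nat.mul_le_mul_left _ h
    refine ⟨h1, ?_⟩
    have hXa : X ≤ antichainQ t m (j + 1) := by
      refine le_of_pow_le_pow_left₀ (n := 4) (by norm_num) (Nat.zero_le _) ?_
      exact ((le_max_right _ _).trans htm).trans
        (htm2.trans ((cardQ_mono (by omega) (by omega)).trans h1))
    calc cardQ t m (j + 1) ^ C ≤ (antichainQ t m (j + 1) ^ 4) ^ C := Nat.pow_le_pow_left h1 C
      _ = antichainQ t m (j + 1) ^ (4 * C) := (pow_mul _ _ _).symm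
      _ ≤ 2 ^ antichainQ t m (j + 1) := hX _ hXa
      _ ≤ cardQ t m (j + 2) := two_pow_antichainQ_le (by omega)
  have hfew : ∀ j, 1 ≤ j → (cardQ t m j + 1) ^ 4 ≤ cardQ t m (j + 1) ^ 3 := by
    intro j hj
    induction j, hj using Nat.le_induction with
    | base => exact (Nat.pow_le_pow_left (cardQ_one_add_one_le hm ht) 4).trans hbase
    | succ j hj ih =>
      have h2 : 2 ≤ cardQ t m (j + 1) := two_le_cardQ hm ht (by omega)
      calc (cardQ t m (j + 1) + 1) ^ 4 ≤ (cardQ t m (j + 1) ^ 2) ^ 4 :=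
            Nat.pow_le_pow_left (by nlinarith) 4
        _ = cardQ t m (j + 1) ^ 8 := (pow_mul _ _ _).symm
        _ ≤ cardQ t m (j + 1) ^ (C * 3) := Nat.pow_le_pow_right (by omega) (by omega)
        _ = (cardQ t m (j + 1) ^ C) ^ 3 := pow_mul _ _ _
        _ ≤ cardQ t m (j + 1 + 1) ^ 3 := Nat.pow_le_pow_left (hstep j hj ih).2 3
  intro j hj
  obtain ⟨j, rfl⟩ := Nat.exists_eq_add_of_le' (show 1 ≤ j by omega)
  exact hstep j (by omega) (hfew j (by omega))

theorem prod_antichainQ_le {t m : ℕ} (hsq : ∀ j, 2 ≤ j → cardQ t m j ^ 2 ≤ cardQ t m (j + 1))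
    {j : ℕ} (hj : 2 ≤ j) : ∏ i ∈ Finset.Icc 1 j, antichainQ t m i ≤ cardQ t m j ^ 2 := by
  induction j, hj using Nat.le_induction with
  | base =>
    rw [Finset.prod_Icc_succ_top (by omega), Finset.Icc_self, Finset.prod_singleton, sq]
    exact Nat.mul_le_mul ((antichainQ_le_cardQ _ _ _).trans (cardQ_mono le_rfl (by omega)))
      (antichainQ_le_cardQ _ _ _)
  | succ j hj ih =>
    rw [Finset.prod_Icc_succ_top (by omega), sq (cardQ t m (j + 1))]
    exact Nat.mul_le_mul (ih.trans (hsq j hj)) (antichainQ_le_cardQ _ _ _)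

theorem antichainQ_le_logb {t m j : ℕ} (hj : 1 ≤ j) :
    (antichainQ t m j : ℝ) ≤ Real.logb 2 (cardQ t m (j + 1)) := by
  have h : ((2 : ℝ) ^ antichainQ t m j) ≤ cardQ t m (j + 1) := by
    exact_mod_cast two_pow_antichainQ_le hj
  rw [Real.le_logb_iff_rpow_le one_lt_two (lt_of_lt_of_le (by positivity) h), Real.rpow_natCast]
  exact h

theorem natCast_le_rpow_of_pow_le {X a K : ℕ} {ε : ℝ} (hK : 1 ≤ K * ε) (ha : 1 ≤ a)
    (h : X ^ K ≤ a) : (X : ℝ) ≤ (a : ℝ) ^ ε := by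
  have hK0 : K ≠ 0 := by rintro rfl; norm_num at hK
  have hK' : (0 : ℝ) < K := by exact_mod_cast Nat.pos_of_ne_zero hK0
  have ha' : (1 : ℝ) ≤ a := by exact_mod_cast ha
  refine le_of_pow_le_pow_left₀ hK0 (by positivity) ?_
  calc (X : ℝ) ^ K ≤ a := by exact_mod_cast h
    _ = (a : ℝ) ^ (1 : ℝ) := (Real.rpow_one _).symm
    _ ≤ (a : ℝ) ^ (ε * K) := Real.rpow_le_rpow_of_exponent_le ha' (by linarith)
    _ = ((a : ℝ) ^ ε) ^ K := Real.rpow_mul_natCast (by positivity) _ _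

/-! ### The bounds -/

theorem onlineSizeRamsey_tightPath_le {k m t : ℕ} (hk : 2 ≤ k) (hm : 2 ≤ m) (ht : 2 ≤ t) :
    onlineSizeRamsey t (tightPath k (k + m - 1)) ≤
      ((cardQ t m k * cardQ t m (k - 1) *
        ∏ i ∈ Finset.Icc 1 (k - 1), antichainQ t m i : ℕ) : ℕ∞) := by
  obtain ⟨s, rfl⟩ := Nat.exists_eq_add_of_le' hk
  refine iInf₂_le_of_le _ ⟨_, builderForces_tightPath hm rfl⟩ (Nat.cast_le.2 ?_)
  rw [show s + 2 - 1 = s + 1 by omega, ← Finset.mul_prod_Ioc_eq_prod_Icc (by omega),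
    show Finset.Ioc 1 (s + 1) = Finset.Icc 2 (s + 1) from rfl, ← forcingCost]
  have h1 : 2 ≤ cardQ t m (s + 1) := two_le_cardQ hm ht (by omega)
  have h2 : cardQ t m (s + 1) + 1 ≤ cardQ t m (s + 2) := cardQ_add_one_le (by omega)
  have h3 : 2 ≤ antichainQ t m 1 := ht.trans (le_antichainQ_one hm)
  -- The factor `a_1 ≥ 2` makes up for the two summands `1`.
  have h4 : (cardQ t m (s + 2) + 1) * (cardQ t m (s + 1) + 1) ≤
      cardQ t m (s + 2) * cardQ t m (s + 1) * antichainQ t m 1 :=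
    le_trans (by nlinarith) (Nat.mul_le_mul_left _ h3)
  calc _ = (cardQ t m (s + 2) + 1) * (cardQ t m (s + 1) + 1) * forcingCost t m s := by ring
    _ ≤ _ := Nat.mul_le_mul_right _ h4
    _ = _ := by ring

theorem bound_three {m t K : ℕ} {ε : ℝ} (hε : 0 < ε) (hm : 2 ≤ m) (ht : 2 ≤ t) (hK : 1 ≤ K * ε)
    (h : t ^ (3 * K + 1) ≤ m ^ (t - 1)) :
    (cardQ t m 3 : ℝ) * (cardQ t m 2 : ℝ) * (antichainQ t m 2 : ℝ) * (antichainQ t m 1 : ℝ) ≤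
      (cardQ t m 3 : ℝ) *
        Real.logb 2 (cardQ t m 3 : ℝ) ^ ((2 : ℝ) + 1 / ((t : ℝ) - 1) + ε) := by
  have hq : cardQ t m 2 ≤ antichainQ t m 2 * (t * m) :=
    (cardQ_succ_le le_rfl).trans (Nat.mul_le_mul_left _ (cardQ_one_add_one_le hm ht))
  have hmt : m ^ (t - 1) ≤ antichainQ t m 2 * t := by
    refine Nat.le_of_mul_le_mul_right (c := m) ?_ (by omega)
    rw [← pow_succ, Nat.sub_add_cancel (by omega), mul_assoc]
    exact (pow_le_cardQ_two t m).trans hq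
  have htK : (t ^ 3) ^ K ≤ antichainQ t m 2 := by
    refine Nat.le_of_mul_le_mul_right (c := t) ?_ (by omega)
    rw [← pow_mul, ← pow_succ]
    exact h.trans hmt
  have ha1 : 1 ≤ antichainQ t m 2 := le_trans (Nat.one_le_pow _ _ (pow_pos (by omega) 3)) htK
  have hL := antichainQ_le_logb (t := t) (m := m) (j := 2) (by omega)
  have hq' : (cardQ t m 2 : ℝ) ≤ antichainQ t m 2 * (t * m) := by exact_mod_cast hq
  have hmt' : (m : ℝ) ^ (t - 1) ≤ antichainQ t m 2 * t := by exact_mod_cast hmt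
  have ht3 : (t : ℝ) ^ 3 ≤ (antichainQ t m 2 : ℝ) ^ ε := by
    exact_mod_cast natCast_le_rpow_of_pow_le hK ha1 htK
  have hat : (antichainQ t m 1 : ℝ) ≤ t := by exact_mod_cast antichainQ_one_le t m
  have ha : (1 : ℝ) ≤ antichainQ t m 2 := by exact_mod_cast ha1
  set a : ℝ := (antichainQ t m 2 : ℝ)
  have ht' : (2 : ℝ) ≤ t := by exact_mod_cast ht
  have hd : (0 : ℝ) < t - 1 := by linarith
  have hm' : (m : ℝ) ≤ a ^ (1 / ((t : ℝ) - 1)) * t := by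
    calc (m : ℝ) = ((m : ℝ) ^ (t - 1)) ^ (1 / ((t : ℝ) - 1)) := by
          rw [← Real.rpow_natCast, ← Real.rpow_mul (by positivity), Nat.cast_sub (by omega),
            Nat.cast_one, mul_one_div_cancel hd.ne', Real.rpow_one]
      _ ≤ (a * t) ^ (1 / ((t : ℝ) - 1)) := Real.rpow_le_rpow (by positivity) hmt' (by positivity)
      _ = a ^ (1 / ((t : ℝ) - 1)) * (t : ℝ) ^ (1 / ((t : ℝ) - 1)) :=
          Real.mul_rpow (by positivity) (by positivity)
      _ ≤ a ^ (1 / ((t : ℝ) - 1)) * t := by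
          refine mul_le_mul_of_nonneg_left ?_ (by positivity)
          refine Real.rpow_le_self_of_one_le (by linarith) ?_
          rw [div_le_one hd]
          linarith
  rw [mul_assoc, mul_assoc]
  refine mul_le_mul_of_nonneg_left ?_ (Nat.cast_nonneg _)
  calc (cardQ t m 2 : ℝ) * (a * (antichainQ t m 1 : ℝ))
      ≤ (a * (t * (a ^ (1 / ((t : ℝ) - 1)) * t))) * (a * t) := by gcongr; exact hq'.trans (by gcongr)
    _ = a ^ (2 : ℝ) * a ^ (1 / ((t : ℝ) - 1)) * (t : ℝ) ^ 3 := by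
        rw [show (2 : ℝ) = ((2 : ℕ) : ℝ) by norm_num, Real.rpow_natCast]; ring
    _ ≤ a ^ (2 : ℝ) * a ^ (1 / ((t : ℝ) - 1)) * a ^ ε := by gcongr
    _ = a ^ ((2 : ℝ) + 1 / ((t : ℝ) - 1) + ε) := by
        rw [Real.rpow_add (by linarith), Real.rpow_add (by linarith)]
    _ ≤ _ := Real.rpow_le_rpow (by linarith) hL (by positivity)

theorem bound_of_four_le {m t K k : ℕ} {ε : ℝ} (hε : 0 < ε) (hm : 2 ≤ m) (ht : 2 ≤ t)
    (hK : 1 ≤ K * ε) (hk : 4 ≤ k)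
    (h : ∀ j, 2 ≤ j →
      cardQ t m j ≤ antichainQ t m j ^ 4 ∧ cardQ t m j ^ (16 * K) ≤ cardQ t m (j + 1)) :
    (cardQ t m k : ℝ) * (cardQ t m (k - 1) : ℝ) *
        ∏ i ∈ Finset.Icc 1 (k - 1), (antichainQ t m i : ℝ) ≤
      (cardQ t m k : ℝ) * Real.logb 2 (cardQ t m k : ℝ) ^ ((2 : ℝ) + ε) := by
  obtain ⟨j, rfl⟩ := Nat.exists_eq_add_of_le' (show 2 ≤ k by omega)
  have hK0 : 1 ≤ K := Nat.one_le_iff_ne_zero.2 (by rintro rfl; norm_num at hK)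
  have hq2 : ∀ i, 1 ≤ i → 2 ≤ cardQ t m i := fun i hi => two_le_cardQ hm ht hi
  have hq := hq2 j (by omega)
  have hprod : ∏ i ∈ Finset.Icc 1 j, antichainQ t m i ≤ cardQ t m j ^ 2 :=
    prod_antichainQ_le (fun i hi => le_trans
      (Nat.pow_le_pow_right (by have := hq2 i (by omega); omega) (by omega)) (h i hi).2) (by omega)
  have hqa : (cardQ t m j ^ 4) ^ K ≤ antichainQ t m (j + 1) := by
    refine le_of_pow_le_pow_left₀ (n := 4) (by norm_num) (Nat.zero_le _) ?_
    calc ((cardQ t m j ^ 4) ^ K) ^ 4 = cardQ t m j ^ (16 * K) := by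
          rw [← pow_mul, ← pow_mul]; congr 1; ring
      _ ≤ _ := (h j (by omega)).2.trans (h (j + 1) (by omega)).1
  have ha1 : 1 ≤ antichainQ t m (j + 1) :=
    le_trans (Nat.one_le_pow _ _ (pow_pos (by omega) 4)) hqa
  have hmain : cardQ t m (j + 1) * ∏ i ∈ Finset.Icc 1 (j + 1), antichainQ t m i ≤
      antichainQ t m (j + 1) ^ 2 * cardQ t m j ^ 4 := by
    rw [Finset.prod_Icc_succ_top (by omega)]
    calc _ ≤ antichainQ t m (j + 1) * (cardQ t m j + 1) *
          (cardQ t m j ^ 2 * antichainQ t m (j + 1)) :=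
          Nat.mul_le_mul (cardQ_succ_le (by omega)) (Nat.mul_le_mul_right _ hprod)
      _ ≤ antichainQ t m (j + 1) * cardQ t m j ^ 2 *
          (cardQ t m j ^ 2 * antichainQ t m (j + 1)) :=
          Nat.mul_le_mul_right _ (Nat.mul_le_mul_left _ (by nlinarith))
      _ = _ := by ring
  have hL := antichainQ_le_logb (t := t) (m := m) (j := j + 1) (by omega)
  have hqε := natCast_le_rpow_of_pow_le hK ha1 hqa
  have hmain' : (cardQ t m (j + 1) : ℝ) * ∏ i ∈ Finset.Icc 1 (j + 1), (antichainQ t m i : ℝ) ≤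
      (antichainQ t m (j + 1) : ℝ) ^ 2 * ((cardQ t m j ^ 4 : ℕ) : ℝ) := by exact_mod_cast hmain
  have ha : (1 : ℝ) ≤ antichainQ t m (j + 1) := by exact_mod_cast ha1
  rw [show j + 2 - 1 = j + 1 by omega, mul_assoc]
  refine mul_le_mul_of_nonneg_left ?_ (Nat.cast_nonneg _)
  calc _ ≤ (antichainQ t m (j + 1) : ℝ) ^ 2 * ((cardQ t m j ^ 4 : ℕ) : ℝ) := hmain'
    _ ≤ (antichainQ t m (j + 1) : ℝ) ^ 2 * (antichainQ t m (j + 1) : ℝ) ^ ε := by gcongr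
    _ = (antichainQ t m (j + 1) : ℝ) ^ ((2 : ℝ) + ε) := by
        rw [Real.rpow_add (by linarith), Real.rpow_two]
    _ ≤ _ := Real.rpow_le_rpow (by linarith) hL (by positivity)

theorem mainTheorem1 :
    (∀ k m t r : ℕ, 2 ≤ k → 2 ≤ m → 2 ≤ t → r = k + m - 1 →
      onlineSizeRamsey t (tightPath k r) ≤
        ((cardQ t m k * cardQ t m (k - 1) *
          ∏ i ∈ Finset.Icc 1 (k - 1), antichainQ t m i : ℕ) : ℕ∞)) ∧
    (∀ ε : ℝ, 0 < ε → ∃ M : ℕ, ∀ m t : ℕ, 2 ≤ m → 2 ≤ t → M ≤ t * m →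
      ((cardQ t m 3 : ℝ) * (cardQ t m 2 : ℝ) * (antichainQ t m 2 : ℝ) * (antichainQ t m 1 : ℝ) ≤
        (cardQ t m 3 : ℝ) *
          Real.logb 2 (cardQ t m 3 : ℝ) ^ ((2 : ℝ) + 1 / ((t : ℝ) - 1) + ε)) ∧
      (∀ k : ℕ, 4 ≤ k →
        (cardQ t m k : ℝ) * (cardQ t m (k - 1) : ℝ) *
            ∏ i ∈ Finset.Icc 1 (k - 1), (antichainQ t m i : ℝ) ≤
          (cardQ t m k : ℝ) * Real.logb 2 (cardQ t m k : ℝ) ^ ((2 : ℝ) + ε))) := by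
  refine ⟨fun k m t r hk hm ht hr => hr ▸ onlineSizeRamsey_tightPath_le hk hm ht, fun ε hε => ?_⟩
  obtain ⟨K, hK⟩ := exists_nat_ge (1 / ε)
  rw [div_le_iff₀ hε] at hK
  have hK0 : 1 ≤ K := Nat.one_le_iff_ne_zero.2 (by rintro rfl; norm_num at hK)
  obtain ⟨M₁, hM₁⟩ := exists_forall_pow_le_pow_sub_one (3 * K + 1)
  obtain ⟨M₂, hM₂⟩ := exists_forall_cardQ_pow_le (C := 16 * K) (by omega)
  refine ⟨max M₁ M₂, fun m t hm ht h => ⟨?_, fun k hk => ?_⟩⟩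
  · exact bound_three hε hm ht hK (hM₁ m t hm ht ((le_max_left _ _).trans h))
  · exact bound_of_four_le hε hm ht hK hk (hM₂ m t hm ht ((le_max_right _ _).trans h))
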